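/- Let $n\ge 2$, let $V=\mathbb R^n$ with its Euclidean inner product, and let $G$ be a finite group of orthogonal transformations of $V$ that is generated by reflections and essential, i.e. $0$ is the only vector of $V$ fixed by all of $G$. Let $\mathcal H\subseteq V$ be the union of the reflection hyperplanes $\ker(g-\mathrm{id})$, where $g$ ranges over the reflections in $G$. Let $\mathbb R[V]^G$ be the algebra of real polynomials on $V$ that are invariant under $(g\cdot f)(x)=f(g^{-1}x)$, and let $\pi_1,\dots,\pi_n$ be any set of basic invariants of $G$, i.e. algebraically independent homogeneous polynomials that generate the algebra $\mathbb R[V]^G$, labelled so that $\deg\pi_1\le\dots\le\deg\pi_n$. For a polynomial $f$ write $V_{\mathbb R}(f)=\{x\in V: f(x)=0\}$. (1) If $f\in\mathbb R[V]^G$ and $\deg f<2\deg\pi_n$, then $V_{\mathbb R}(f)\neq\emptyset$ if and only if $V_{\mathbb R}(f)\cap\mathcal H\neq\emptyset$. Moreover, for such $f$ (in particular for homogeneous $f$), $f\ge 0$ on $V$ if and only if $f\ge 0$ on $\mathcal H$. (2) The degree bound is tight: $V\setminus\mathcal H\ne\emptyset$, and for every $a\in V\setminus\mathcal H$ the polynomial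 $f=\sum_{i=1}^n(\pi_i-\pi_i(a))^2$ lies in $\mathbb R[V]^G$, has degree exactly $2\deg\pi_n$, and $V_{\mathbb R}(f)$ is exactly the orbit $Ga$; so $V_{\mathbb R}(f)$ is nonempty but does not meet $\mathcal H$. -/

import Mathlib

/-- An orthogonal transformation of `ℝⁿ` is a reflection if it is the orthogonal reflection in the
hyperplane `v^⊥` for some nonzero vector `v`. -/
def IsOrthogonalReflection {n : ℕ}
    (g : EuclideanSpace ℝ (Fin n) ≃ₗᵢ[ℝ] EuclideanSpace ℝ (Fin n)) : Prop :=
  ∃ v : EuclideanSpace ℝ (Fin n), v ≠ 0 ∧ g = (Submodule.span ℝ {v})ᗮ.reflection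

/-- A (real) reflection group: a finite group of orthogonal transformations that is generated by
the reflections it contains. -/
structure IsReflectionGroup {n : ℕ}
    (G : Subgroup (EuclideanSpace ℝ (Fin n) ≃ₗᵢ[ℝ] EuclideanSpace ℝ (Fin n))) : Prop where
  finite : Finite G
  closure_reflections : Subgroup.closure {g | g ∈ G ∧ IsOrthogonalReflection g} = G

/-- `G` is essential: no nonzero vector is fixed by all of `G`. -/
def IsEssentialGroup {n : ℕ}
    (G : Subgroup (EuclideanSpace ℝ (Fin n) ≃ₗᵢ[ℝ] EuclideanSpace ℝ (Fin n))) : Prop :=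
  ∀ v : EuclideanSpace ℝ (Fin n), (∀ g ∈ G, g v = v) → v = 0

/-- The reflection arrangement of `G`: the set of the hyperplanes `ker (g - id)` for the
reflections `g` in `G`. -/
def reflectionArrangement {n : ℕ}
    (G : Subgroup (EuclideanSpace ℝ (Fin n) ≃ₗᵢ[ℝ] EuclideanSpace ℝ (Fin n))) :
    Set (Submodule ℝ (EuclideanSpace ℝ (Fin n))) :=
  {H | ∃ g ∈ G, IsOrthogonalReflection g ∧
    H = LinearMap.ker (g.toLinearEquiv.toLinearMap - LinearMap.id)}

/-- The set of points of `ℝⁿ` that lie on some hyperplane of the reflection arrangement. -/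
def arrangementPoints {n : ℕ}
    (G : Subgroup (EuclideanSpace ℝ (Fin n) ≃ₗᵢ[ℝ] EuclideanSpace ℝ (Fin n))) :
    Set (EuclideanSpace ℝ (Fin n)) :=
  ⋃ H ∈ reflectionArrangement G, (H : Set (EuclideanSpace ℝ (Fin n)))

/-- The value of a real polynomial in `n` variables at a point of `ℝⁿ`. -/
noncomputable def polyValue {n : ℕ} (f : MvPolynomial (Fin n) ℝ)
    (x : EuclideanSpace ℝ (Fin n)) : ℝ :=
  MvPolynomial.eval (fun i => x i) f

/-- The real zero set of a polynomial. -/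
def realZeros {n : ℕ} (f : MvPolynomial (Fin n) ℝ) : Set (EuclideanSpace ℝ (Fin n)) :=
  {x | polyValue f x = 0}

/-- The algebra of `G`-invariant polynomials for the action `(g • f)(x) = f (g⁻¹ x)`. As `ℝ` is
infinite, a polynomial is determined by its values. -/
def invariantPolynomials {n : ℕ}
    (G : Subgroup (EuclideanSpace ℝ (Fin n) ≃ₗᵢ[ℝ] EuclideanSpace ℝ (Fin n))) :
    Subalgebra ℝ (MvPolynomial (Fin n) ℝ) where
  carrier := {f | ∀ g ∈ G, ∀ x, polyValue f (g⁻¹ x) = polyValue f x}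
  mul_mem' := by
    intro a b ha hb g hg x
    have h1 := ha g hg x
    have h2 := hb g hg x
    simp only [polyValue, map_mul] at h1 h2 ⊢
    rw [h1, h2]
  add_mem' := by
    intro a b ha hb g hg x
    have h1 := ha g hg x
    have h2 := hb g hg x
    simp only [polyValue, map_add] at h1 h2 ⊢
    rw [h1, h2]
  algebraMap_mem' := by
    intro r g hg x
    simp [polyValue, MvPolynomial.algebraMap_eq]

/-- `p 0, …, p (n - 1)` is a set of basic invariants of `G`: algebraically independent homogeneous
polynomials that generate the algebra of invariants, labelled by nondecreasing degree. -/
structure IsBasicInvariants {n : ℕ}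
    (G : Subgroup (EuclideanSpace ℝ (Fin n) ≃ₗᵢ[ℝ] EuclideanSpace ℝ (Fin n)))
    (p : Fin n → MvPolynomial (Fin n) ℝ) : Prop where
  homogeneous : ∀ i, (p i).IsHomogeneous (p i).totalDegree
  algebraicIndependent : AlgebraicIndependent ℝ p
  adjoin_eq : Algebra.adjoin ℝ (Set.range p) = invariantPolynomials G
  degree_mono : Monotone fun i => (p i).totalDegree

/-!
Let `π = (p 0, …, p (n - 1))` be the orbit map. If `deg f < 2 deg p (n - 1)`, then `f = F ∘ π` with
`F` affine along some line of the orbit space on which `‖x‖²`, itself an affine function of `π`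
because all degrees are at least two, is constant. The preimage of that line is therefore compact.
At a point of it whose image is extremal on the line `π` is not locally surjective, so its Jacobian
vanishes, and such a point lies on the arrangement: the values of `f` are bounded by values on the
arrangement, a connected set as it is star-shaped.

That the Jacobian `J` vanishes only on the arrangement is seen as follows. A linear form `⟪u, ·⟫` is
a root of its orbit polynomial, whose coefficients are invariants; differentiating this relation
shows that `∏_{g ≠ 1} ⟪u - g u, ·⟫` times the gradient of `⟪u, ·⟫` is a combination of the gradients
of the `p i`. For a basis of vectors `u` it follows that `J` divides a product of linear forms, so
each zero of `J` lies on a hyperplane consisting of zeros of `J`. A generic choice of the basis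
shows that `J` does not vanish at a point with trivial stabilizer, so that hyperplane is fixed
pointwise by some `g ≠ 1`, which must be its reflection.
-/

section

open MvPolynomial

theorem exists_prime_dvd_and_map_eq_zero {R S ι : Type*} [CommRing R] [IsDomain R] [CommRing S]
    [IsDomain S] (φ : R →+* S) {x a : R} {s : Finset ι} {f : ι → R} (ha : IsUnit a)
    (hf : ∀ i ∈ s, Prime (f i)) (hx : x ∣ a * ∏ i ∈ s, f i) (hφ : φ x = 0) :
    ∃ i ∈ s, f i ∣ x ∧ φ (f i) = 0 := by
  classical
  obtain ⟨y, hy⟩ := hx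
  obtain ⟨t, u, b, c, rfl, -, rfl, rfl, -⟩ := mul_eq_mul_prime_prod hf hy.symm
  have hb : φ b ≠ 0 := ((isUnit_of_mul_isUnit_left ha).map φ).ne_zero
  rw [map_mul, map_prod, mul_eq_zero, or_iff_right hb, Finset.prod_eq_zero_iff] at hφ
  obtain ⟨i, hi, hi0⟩ := hφ
  exact ⟨i, Finset.mem_union_left _ hi, (Finset.dvd_prod_of_mem f hi).mul_left b, hi0⟩

theorem exists_linearIndependent_forall_notMem {K V ι : Type*} [Field K] [Infinite K]
    [AddCommGroup V] [Module K V] [Module.Finite K V] [Finite ι] {d : ℕ}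
    (hd : Module.finrank K V = d) (W : ι → Submodule K V) (hW : ∀ i, W i ≠ ⊤) :
    ∃ u : Fin d → V, LinearIndependent K u ∧ ∀ k i, u k ∉ W i := by
  have hspan : Submodule.span K {x | ∀ i, x ∉ W i} = ⊤ := by
    by_contra hne
    obtain ⟨x, hx⟩ := Submodule.exists_forall_notMem_of_forall_ne_top
      (fun o : Option ι => o.elim (Submodule.span K {x | ∀ i, x ∉ W i}) W)
      (Option.forall.2 ⟨hne, hW⟩)
    exact hx none (Submodule.subset_span fun i => hx (some i))
  have hbasis := Submodule.exists_fun_fin_finrank_span_eq K {x | ∀ i, x ∉ W i}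
  rw [hspan, finrank_top, hd] at hbasis
  obtain ⟨u, hu, -, hli⟩ := hbasis
  exact ⟨u, hli, hu⟩

theorem derivative_eval_smul_mem {R A M : Type*} [CommRing R] [CommRing A] [Algebra R A]
    [AddCommGroup M] [Module A M] [Module R M] (d : Derivation R A M) (N : Submodule A M)
    {P : Polynomial A} {r : A} (hP : ∀ k, d (P.coeff k) ∈ N) (hr : P.eval r = 0) :
    P.derivative.eval r • d r ∈ N := by
  have hcoeff : PolynomialModule.eval r (d.mapCoeffs P) ∈ N :=
    Submodule.sum_mem _ fun k _ => N.smul_mem _ (hP k)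
  have h := d.apply_eval_eq r P
  rw [hr, map_zero] at h
  exact (N.add_mem_iff_right hcoeff).1 (h ▸ N.zero_mem)

theorem det_dvd_of_forall_mem_span {R ι : Type*} [CommRing R] [Fintype ι] [DecidableEq ι]
    {A B : Matrix ι ι R} (h : ∀ i, B i ∈ Submodule.span R (Set.range A)) : A.det ∣ B.det := by
  choose c hc using fun i => (Submodule.mem_span_range_iff_exists_fun R).1 (h i)
  have hB : B = Matrix.of c * A := by
    ext i j
    simp [← hc i, Matrix.mul_apply, Finset.sum_apply]
  exact hB ▸ Matrix.det_mul (Matrix.of c) A ▸ dvd_mul_left _ _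

section Invariants

variable {n : ℕ}

theorem continuous_polyValue (f : MvPolynomial (Fin n) ℝ) : Continuous (polyValue f) :=
  (MvPolynomial.continuous_eval f).comp (by fun_prop)

/-- The linear form `⟪c, ·⟫` on `ℝⁿ`, as a polynomial. -/
noncomputable def linearForm : EuclideanSpace ℝ (Fin n) →ₗ[ℝ] MvPolynomial (Fin n) ℝ :=
  sumSMulX ∘ₗ (Finsupp.linearEquivFunOnFinite ℝ ℝ (Fin n)).symm.toLinearMap ∘ₗ
    (WithLp.linearEquiv 2 ℝ (Fin n → ℝ)).toLinearMap

theorem linearForm_apply (c : EuclideanSpace ℝ (Fin n)) :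
    linearForm c = ∑ i, C (c i) * X i := by
  simp [linearForm, sumSMulX, Finsupp.linearCombination_apply, Finsupp.sum_fintype, smul_eq_C_mul]

theorem polyValue_linearForm (c x : EuclideanSpace ℝ (Fin n)) :
    polyValue (linearForm c) x = inner ℝ c x := by
  simp [polyValue, linearForm_apply, PiLp.inner_apply, mul_comm]

theorem prime_linearForm {c : EuclideanSpace ℝ (Fin n)} (hc : c ≠ 0) : Prime (linearForm c) := by
  obtain ⟨i, hi⟩ : ∃ i, c i ≠ 0 := by
    by_contra! h
    exact hc (PiLp.ext h)
  refine (irreducible_sumSMulX _ ⟨i, ?_⟩ fun r hr => ?_).prime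
  · simpa using hi
  · exact isUnit_of_dvd_unit (hr i) (isUnit_iff_ne_zero.2 hi)

variable {G : Subgroup (EuclideanSpace ℝ (Fin n) ≃ₗᵢ[ℝ] EuclideanSpace ℝ (Fin n))}

/-- The monic polynomial whose roots are the linear forms of the vectors in the orbit of `c`. -/
noncomputable def orbitPolynomial
    (G : Subgroup (EuclideanSpace ℝ (Fin n) ≃ₗᵢ[ℝ] EuclideanSpace ℝ (Fin n))) [Fintype G]
    (c : EuclideanSpace ℝ (Fin n)) : Polynomial (MvPolynomial (Fin n) ℝ) :=
  ∏ g : G, (Polynomial.X - Polynomial.C (linearForm (g.1 c)))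

theorem inner_inv_apply {E : Type*} [NormedAddCommGroup E] [InnerProductSpace ℝ E]
    (g : E ≃ₗᵢ[ℝ] E) (c x : E) : inner ℝ c (g⁻¹ x) = inner ℝ (g c) x := by
  rw [← g.inner_map_map c (g⁻¹ x)]
  exact congrArg _ (g.apply_symm_apply x)

theorem map_orbitPolynomial [Fintype G] (c x : EuclideanSpace ℝ (Fin n)) :
    (orbitPolynomial G c).map (eval fun i => x i) =
      ∏ g : G, (Polynomial.X - Polynomial.C (inner ℝ (g.1 c) x)) := by
  simp only [orbitPolynomial, Polynomial.map_prod, Polynomial.map_sub, Polynomial.map_X,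
    Polynomial.map_C, ← polyValue_linearForm, polyValue]

theorem coeff_orbitPolynomial_mem [Fintype G] (c : EuclideanSpace ℝ (Fin n)) (k : ℕ) :
    (orbitPolynomial G c).coeff k ∈ invariantPolynomials G := by
  intro h hh x
  have hmap : (orbitPolynomial G c).map (eval fun i => (h⁻¹ x) i) =
      (orbitPolynomial G c).map (eval fun i => x i) := by
    simp only [map_orbitPolynomial, inner_inv_apply]
    exact Equiv.prod_comp (Equiv.mulLeft (⟨h, hh⟩ : G))
      fun g : G => Polynomial.X - Polynomial.C (inner ℝ (g.1 c) x)
  simpa only [Polynomial.coeff_map, polyValue] using congrArg (fun q => q.coeff k) hmap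

theorem eval_orbitPolynomial [Fintype G] (c : EuclideanSpace ℝ (Fin n)) :
    (orbitPolynomial G c).eval (linearForm c) = 0 := by
  rw [orbitPolynomial, Polynomial.eval_prod]
  exact Finset.prod_eq_zero (Finset.mem_univ (1 : G)) (by simp)

theorem eval_derivative_orbitPolynomial [Fintype G] [DecidableEq G]
    (c : EuclideanSpace ℝ (Fin n)) :
    (orbitPolynomial G c).derivative.eval (linearForm c) =
      ∏ g ∈ Finset.univ.erase (1 : G), linearForm (c - g.1 c) := by
  rw [orbitPolynomial, ← Finset.mul_prod_erase _ _ (Finset.mem_univ (1 : G))]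
  simp [Polynomial.eval_prod]

end Invariants

section Jacobian

variable {R σ : Type*} [CommRing R]

/-- The gradient of a polynomial, as a derivation into vectors of polynomials. -/
noncomputable def polyGradient [DecidableEq σ] :
    Derivation R (MvPolynomial σ R) (σ → MvPolynomial σ R) :=
  mkDerivation R fun i => Pi.single i 1

theorem polyGradient_X [DecidableEq σ] (i : σ) :
    polyGradient (X i : MvPolynomial σ R) = Pi.single i 1 :=
  mkDerivation_X ..

theorem polyGradient_mem_span [DecidableEq σ] {ι : Type*} {p : ι → MvPolynomial σ R}
    {f : MvPolynomial σ R} (hf : f ∈ Algebra.adjoin R (Set.range p)) :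
    polyGradient f ∈ Submodule.span (MvPolynomial σ R) (Set.range fun i => polyGradient (p i)) := by
  induction hf using Algebra.adjoin_induction with
  | mem f hf =>
    obtain ⟨i, rfl⟩ := hf
    exact Submodule.subset_span ⟨i, rfl⟩
  | algebraMap r => simp
  | add f g _ _ hf hg => simpa using add_mem hf hg
  | mul f g _ _ hf hg =>
    simpa using add_mem (Submodule.smul_mem _ f hg) (Submodule.smul_mem _ g hf)

/-- The determinant of the Jacobian matrix of a family of polynomials. -/
noncomputable def jacobian [Fintype σ] [DecidableEq σ] (p : σ → MvPolynomial σ R) :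
    MvPolynomial σ R :=
  (Matrix.of fun i => polyGradient (p i)).det

end Jacobian

section JacobianOfInvariants

variable {n : ℕ} {G : Subgroup (EuclideanSpace ℝ (Fin n) ≃ₗᵢ[ℝ] EuclideanSpace ℝ (Fin n))}
  {p : Fin n → MvPolynomial (Fin n) ℝ}

theorem polyGradient_linearForm (c : EuclideanSpace ℝ (Fin n)) (j : Fin n) :
    polyGradient (linearForm c) j = C (c j) := by
  simp [linearForm_apply, polyGradient_X, Pi.single_apply]

theorem prod_linearForm_smul_polyGradient_mem_span [Fintype G] [DecidableEq G]
    (hp : Algebra.adjoin ℝ (Set.range p) = invariantPolynomials G)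
    (c : EuclideanSpace ℝ (Fin n)) :
    (∏ g ∈ Finset.univ.erase (1 : G), linearForm (c - g.1 c)) • polyGradient (linearForm c) ∈
      Submodule.span (MvPolynomial (Fin n) ℝ) (Set.range fun i => polyGradient (p i)) := by
  rw [← eval_derivative_orbitPolynomial]
  refine derivative_eval_smul_mem _ _ (fun k => polyGradient_mem_span ?_) (eval_orbitPolynomial c)
  exact hp ▸ coeff_orbitPolynomial_mem c k

theorem jacobian_dvd [Fintype G] [DecidableEq G]
    (hp : Algebra.adjoin ℝ (Set.range p) = invariantPolynomials G)
    (u : Fin n → EuclideanSpace ℝ (Fin n)) :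
    jacobian p ∣ C (Matrix.of fun i j => u i j).det *
      ∏ ig ∈ Finset.univ ×ˢ Finset.univ.erase (1 : G), linearForm (u ig.1 - ig.2.1 (u ig.1)) := by
  have hdvd := det_dvd_of_forall_mem_span (A := Matrix.of fun i => polyGradient (p i))
    (B := Matrix.of fun i => (∏ g ∈ Finset.univ.erase (1 : G), linearForm (u i - g.1 (u i))) •
      polyGradient (linearForm (u i)))
    fun i => prod_linearForm_smul_polyGradient_mem_span hp (u i)
  refine hdvd.trans (dvd_of_eq ?_)
  have hdet : (Matrix.of fun i => polyGradient (linearForm (u i))).det =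
      C (Matrix.of fun i j => u i j).det := by
    rw [RingHom.map_det]
    congr 1
    exact Matrix.ext fun i j => polyGradient_linearForm (u i) j
  rw [Finset.prod_product, mul_comm, ← hdet]
  exact Matrix.det_mul_column _ _

theorem exists_linearIndependent_forall_inner_sub_apply_ne_zero [Finite G]
    {y : EuclideanSpace ℝ (Fin n)} (hy : ∀ g ∈ G, g y = y → g = 1) :
    ∃ u : Fin n → EuclideanSpace ℝ (Fin n), LinearIndependent ℝ u ∧
      ∀ i, ∀ g ∈ G, g ≠ 1 → inner ℝ (u i - g (u i)) y ≠ 0 := by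
  have hW : ∀ g : {g : G // g ≠ 1}, (ℝ ∙ (y - g.1.1⁻¹ y))ᗮ ≠ ⊤ := by
    intro g h
    rw [Submodule.orthogonal_eq_top_iff, Submodule.span_singleton_eq_bot, sub_eq_zero] at h
    have hg := hy _ (G.inv_mem g.1.2) h.symm
    exact g.2 (by simpa using hg)
  obtain ⟨u, hu, hne⟩ := exists_linearIndependent_forall_notMem finrank_euclideanSpace_fin _ hW
  refine ⟨u, hu, fun i g hg hg1 h0 => ?_⟩
  refine hne i ⟨⟨g, hg⟩, by simpa [Subtype.ext_iff] using hg1⟩ ?_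
  rwa [Submodule.mem_orthogonal_singleton_iff_inner_left, inner_sub_right, inner_inv_apply,
    ← inner_sub_left]

theorem isUnit_C_det_of_linearIndependent {u : Fin n → EuclideanSpace ℝ (Fin n)}
    (hu : LinearIndependent ℝ u) :
    IsUnit (C (Matrix.of fun i j => u i j).det : MvPolynomial (Fin n) ℝ) := by
  refine IsUnit.map _ ((Matrix.isUnit_iff_isUnit_det _).1 ?_)
  exact Matrix.linearIndependent_rows_iff_isUnit.1
    (hu.map' (WithLp.linearEquiv 2 ℝ (Fin n → ℝ)).toLinearMap (LinearEquiv.ker _))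

theorem exists_linearForm_sub_dvd_jacobian [Finite G]
    (hp : Algebra.adjoin ℝ (Set.range p) = invariantPolynomials G)
    {u : Fin n → EuclideanSpace ℝ (Fin n)} (hu : LinearIndependent ℝ u)
    (hne : ∀ i, ∀ g ∈ G, g ≠ 1 → u i - g (u i) ≠ 0)
    {x : EuclideanSpace ℝ (Fin n)} (hx : polyValue (jacobian p) x = 0) :
    ∃ i, ∃ g ∈ G, g ≠ 1 ∧ inner ℝ (u i - g (u i)) x = 0 ∧
      linearForm (u i - g (u i)) ∣ jacobian p := by
  classical
  have := Fintype.ofFinite G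
  have hne_one : ∀ g ∈ Finset.univ.erase (1 : G), g.1 ≠ 1 := fun g hg h1 =>
    Finset.ne_of_mem_erase hg (Subtype.ext h1)
  obtain ⟨⟨i, g⟩, hig, hdvd, hzero⟩ := exists_prime_dvd_and_map_eq_zero (eval fun j => x j)
    (isUnit_C_det_of_linearIndependent hu)
    (fun ig hig => prime_linearForm
      (hne ig.1 ig.2.1 ig.2.2 (hne_one _ (Finset.mem_product.1 hig).2)))
    (jacobian_dvd hp u) hx
  refine ⟨i, g.1, g.2, hne_one _ (Finset.mem_product.1 hig).2, ?_, hdvd⟩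
  rw [← polyValue_linearForm]
  exact hzero

theorem polyValue_jacobian_ne_zero_of_trivial_stabilizer [Finite G]
    (hp : Algebra.adjoin ℝ (Set.range p) = invariantPolynomials G)
    {y : EuclideanSpace ℝ (Fin n)} (hy : ∀ g ∈ G, g y = y → g = 1) :
    polyValue (jacobian p) y ≠ 0 := by
  intro hJ
  obtain ⟨u, hu, hne⟩ := exists_linearIndependent_forall_inner_sub_apply_ne_zero hy
  obtain ⟨i, g, hg, hg1, h0, -⟩ := exists_linearForm_sub_dvd_jacobian hp hu
    (fun i g hg hg1 h => hne i g hg hg1 (by rw [h, inner_zero_left])) hJ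
  exact hne i g hg hg1 h0

end JacobianOfInvariants

section Reflections

theorem eq_reflection_of_forall_mem_orthogonal {E : Type*} [NormedAddCommGroup E]
    [InnerProductSpace ℝ E] {v : E} {g : E ≃ₗᵢ[ℝ] E} (hg : g ≠ 1)
    (hfix : ∀ y ∈ (ℝ ∙ v)ᗮ, g y = y) : g = (ℝ ∙ v)ᗮ.reflection := by
  have hgv : g v = v ∨ g v = -v := by
    have hmem : g v ∈ ℝ ∙ v := by
      rw [← Submodule.orthogonal_orthogonal (ℝ ∙ v)]
      intro w hw
      rw [← hfix w hw, g.inner_map_map]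
      exact Submodule.inner_left_of_mem_orthogonal (Submodule.mem_span_singleton_self v) hw
    obtain ⟨r, hr⟩ := Submodule.mem_span_singleton.1 hmem
    rcases eq_or_ne v 0 with rfl | hv
    · simp
    have hnorm : |r| * ‖v‖ = ‖v‖ := by rw [← Real.norm_eq_abs, ← norm_smul, hr, g.norm_map]
    rw [mul_eq_right₀ (norm_ne_zero_iff.2 hv), abs_eq zero_le_one] at hnorm
    rcases hnorm with rfl | rfl
    · exact .inl (by rw [← hr, one_smul])
    · exact .inr (by rw [← hr, neg_one_smul])
  have hdecomp : ∀ x, ∃ r : ℝ, ∃ y ∈ (ℝ ∙ v)ᗮ, x = r • v + y := by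
    intro x
    obtain ⟨w, hw, y, hy, rfl⟩ := (ℝ ∙ v).exists_add_mem_mem_orthogonal x
    obtain ⟨r, rfl⟩ := Submodule.mem_span_singleton.1 hw
    exact ⟨r, y, hy, rfl⟩
  rcases hgv with hgv | hgv
  · refine absurd (LinearIsometryEquiv.ext fun x => ?_) hg
    obtain ⟨r, y, hy, rfl⟩ := hdecomp x
    simp [hgv, hfix y hy]
  · refine LinearIsometryEquiv.ext fun x => ?_
    obtain ⟨r, y, hy, rfl⟩ := hdecomp x
    rw [map_add, map_add, map_smul, map_smul, hgv, hfix y hy,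
      Submodule.reflection_orthogonalComplement_singleton_eq_neg,
      Submodule.reflection_mem_subspace_eq_self hy]

variable {n : ℕ} {G : Subgroup (EuclideanSpace ℝ (Fin n) ≃ₗᵢ[ℝ] EuclideanSpace ℝ (Fin n))}
  {p : Fin n → MvPolynomial (Fin n) ℝ}

theorem mem_arrangementPoints {x : EuclideanSpace ℝ (Fin n)} :
    x ∈ arrangementPoints G ↔ ∃ g ∈ G, IsOrthogonalReflection g ∧ g x = x := by
  simp only [arrangementPoints, reflectionArrangement, Set.mem_iUnion, Set.mem_ofPred_eq]
  constructor
  · rintro ⟨H, ⟨g, hg, hr, rfl⟩, hx⟩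
    exact ⟨g, hg, hr, sub_eq_zero.1 hx⟩
  · rintro ⟨g, hg, hr, hx⟩
    exact ⟨_, ⟨g, hg, hr, rfl⟩, sub_eq_zero.2 hx⟩

theorem exists_forall_mem_apply_eq_of_forall_exists {E : Type*} [NormedAddCommGroup E]
    [NormedSpace ℝ E] {G : Subgroup (E ≃ₗᵢ[ℝ] E)} [Finite G] {W : Submodule ℝ E}
    (hW : ∀ y ∈ W, ∃ g ∈ G, g ≠ 1 ∧ g y = y) : ∃ g ∈ G, g ≠ 1 ∧ ∀ y ∈ W, g y = y := by
  by_contra! h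
  let fixed (g : {g : G // g ≠ 1}) : Submodule ℝ E :=
    LinearMap.eqLocus g.1.1.toLinearEquiv.toLinearMap LinearMap.id
  have hfixed : ∀ g, (fixed g).comap W.subtype ≠ ⊤ := by
    intro g htop
    obtain ⟨y, hy, hgy⟩ := h g.1.1 g.1.2 fun h1 => g.2 (Subtype.ext h1)
    exact hgy (Submodule.comap_subtype_eq_top.1 htop hy)
  obtain ⟨⟨y, hyW⟩, hy⟩ := Submodule.exists_forall_notMem_of_forall_ne_top _ hfixed
  obtain ⟨g, hg, hg1, hgy⟩ := hW y hyW
  exact hy ⟨⟨g, hg⟩, fun h => hg1 (congrArg Subtype.val h)⟩ hgy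

theorem exists_forall_apply_eq_imp_eq_one {E : Type*} [NormedAddCommGroup E] [NormedSpace ℝ E]
    (G : Subgroup (E ≃ₗᵢ[ℝ] E)) [Finite G] : ∃ y, ∀ g ∈ G, g y = y → g = 1 := by
  by_contra! h
  obtain ⟨g, -, hg1, hfix⟩ := exists_forall_mem_apply_eq_of_forall_exists (W := ⊤)
    (fun y _ => (h y).imp fun g hg => ⟨hg.1, hg.2.2, hg.2.1⟩)
  exact hg1 (LinearIsometryEquiv.ext fun x => hfix x Submodule.mem_top)

theorem polyValue_jacobian_ne_zero [Finite G]
    (hp : Algebra.adjoin ℝ (Set.range p) = invariantPolynomials G)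
    {x : EuclideanSpace ℝ (Fin n)} (hx : x ∉ arrangementPoints G) :
    polyValue (jacobian p) x ≠ 0 := by
  intro hJ
  obtain ⟨y, hy⟩ := exists_forall_apply_eq_imp_eq_one G
  obtain ⟨u, hu, hne⟩ := exists_linearIndependent_forall_inner_sub_apply_ne_zero hy
  have hne' : ∀ i, ∀ g ∈ G, g ≠ 1 → u i - g (u i) ≠ 0 := fun i g hg hg1 h =>
    hne i g hg hg1 (by rw [h, inner_zero_left])
  obtain ⟨i, g, hg, hg1, h0, q, hq⟩ := exists_linearForm_sub_dvd_jacobian hp hu hne' hJ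
  -- the Jacobian vanishes on a whole hyperplane through `x`, which is then fixed by some `h`
  obtain ⟨h, hh, hh1, hfix⟩ := exists_forall_mem_apply_eq_of_forall_exists (G := G)
    (W := (ℝ ∙ (u i - g (u i)))ᗮ) (fun z hz => by
      by_contra! hz'
      refine polyValue_jacobian_ne_zero_of_trivial_stabilizer hp
        (fun h hh hhz => by_contra fun hh1 => hz' h hh hh1 hhz) ?_
      rw [Submodule.mem_orthogonal_singleton_iff_inner_right, ← polyValue_linearForm] at hz
      rw [hq, polyValue, map_mul]
      exact mul_eq_zero_of_left hz _)
  refine hx (mem_arrangementPoints.2 ⟨h, hh, ⟨_, hne' i g hg hg1,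
    eq_reflection_of_forall_mem_orthogonal hh1 hfix⟩, hfix x ?_⟩)
  exact Submodule.mem_orthogonal_singleton_iff_inner_right.2 h0

end Reflections

section LocalSurjectivity

open Filter Topology

/-- The map `V → ℝⁿ` with the coordinates `p i`; for basic invariants its fibres are the orbits. -/
noncomputable def orbitMap {n : ℕ} (p : Fin n → MvPolynomial (Fin n) ℝ)
    (x : EuclideanSpace ℝ (Fin n)) : EuclideanSpace ℝ (Fin n) :=
  WithLp.toLp 2 fun i => polyValue (p i) x

theorem exists_range_notMem_nhds_of_isCompact {X F : Type*} [TopologicalSpace X]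
    [NormedAddCommGroup F] [NormedSpace ℝ F] {Φ : X → F} (hΦ : Continuous Φ) (x : X) {u : F}
    (hu : u ≠ 0) (hK : IsCompact {y | Φ y - Φ x ∈ ℝ ∙ u}) :
    ∃ y, ∃ t : ℝ, 0 ≤ t ∧ Φ y = Φ x + t • u ∧ Set.range Φ ∉ 𝓝 (Φ y) := by
  obtain ⟨τ, hτu⟩ := SeparatingDual.exists_eq_one (R := ℝ) hu
  have hτ : ∀ z t, Φ z = Φ x + t • u → τ (Φ z) = τ (Φ x) + t := fun z t hz => by simp [hz, hτu]
  have hmem : ∀ z t, Φ z = Φ x + t • u → Φ z - Φ x ∈ ℝ ∙ u := fun z t hz =>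
    Submodule.mem_span_singleton.2 ⟨t, by rw [hz, add_sub_cancel_left]⟩
  obtain ⟨y, hy, hmax⟩ := hK.exists_isMaxOn ⟨x, hmem x 0 (by simp)⟩
    (τ.continuous.comp hΦ).continuousOn
  obtain ⟨t, ht⟩ := Submodule.mem_span_singleton.1 hy
  have hyt : Φ y = Φ x + t • u := by rw [ht, add_sub_cancel]
  have ht_max : ∀ z s, Φ z = Φ x + s • u → s ≤ t := fun z s hz => by
    have hle : τ (Φ z) ≤ τ (Φ y) := hmax (hmem z s hz)
    rwa [hτ z s hz, hτ y t hyt, add_le_add_iff_left] at hle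
  refine ⟨y, t, ht_max x 0 (by simp), hyt, fun hrange => ?_⟩
  have hline : Tendsto (fun s : ℝ => Φ y + s • u) (𝓝[>] 0) (𝓝 (Φ y)) := by
    have hcont : Continuous fun s : ℝ => Φ y + s • u := by fun_prop
    simpa using (hcont.tendsto 0).mono_left nhdsWithin_le_nhds
  obtain ⟨s, ⟨z, hz⟩, hs⟩ := ((hline.eventually hrange).and self_mem_nhdsWithin).exists
  have hle := ht_max z (t + s) (by rw [hz, hyt, add_assoc, add_smul])
  exact hle.not_gt (lt_add_of_pos_right t hs)

variable {n : ℕ} {G : Subgroup (EuclideanSpace ℝ (Fin n) ≃ₗᵢ[ℝ] EuclideanSpace ℝ (Fin n))}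
  {p : Fin n → MvPolynomial (Fin n) ℝ}

theorem hasStrictFDerivAt_polyValue (f : MvPolynomial (Fin n) ℝ) (x : EuclideanSpace ℝ (Fin n)) :
    HasStrictFDerivAt (polyValue f) (∑ j, polyValue (polyGradient f j) x •
      (EuclideanSpace.proj j : EuclideanSpace ℝ (Fin n) →L[ℝ] ℝ)) x := by
  induction f using MvPolynomial.induction_on with
  | C r =>
    have hC : polyValue (C r : MvPolynomial (Fin n) ℝ) = fun _ => r := by ext; simp [polyValue]
    simpa [hC, polyValue] using hasStrictFDerivAt_const r x
  | add f g hf hg =>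
    have hadd : polyValue (f + g) = polyValue f + polyValue g := by ext; simp [polyValue]
    rw [hadd]
    refine (hf.add hg).congr_fderiv ?_
    simp [polyValue, add_smul, Finset.sum_add_distrib]
  | mul_X f i hf =>
    have hmul : polyValue (f * X i) = fun y => polyValue f y *
        (EuclideanSpace.proj i : EuclideanSpace ℝ (Fin n) →L[ℝ] ℝ) y := by ext; simp [polyValue]
    rw [hmul]
    refine (hf.mul (ContinuousLinearMap.hasStrictFDerivAt _)).congr_fderiv ?_
    simp [polyValue, polyGradient_X, Pi.single_apply, add_smul, Finset.sum_add_distrib,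
      Finset.smul_sum, mul_smul, apply_ite (eval _)]

theorem continuous_orbitMap (p : Fin n → MvPolynomial (Fin n) ℝ) : Continuous (orbitMap p) :=
  (PiLp.continuous_toLp 2 _).comp (continuous_pi fun i => continuous_polyValue (p i))

theorem hasStrictFDerivAt_orbitMap (p : Fin n → MvPolynomial (Fin n) ℝ)
    (x : EuclideanSpace ℝ (Fin n)) :
    HasStrictFDerivAt (orbitMap p) (Matrix.toEuclideanCLM (𝕜 := ℝ) (n := Fin n)
      (Matrix.of fun i j => polyValue (polyGradient (p i) j) x)) x := by
  refine hasStrictFDerivAt_euclidean.2 fun i => ?_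
  refine (hasStrictFDerivAt_polyValue (p i) x).congr_fderiv ?_
  ext v
  simp [Matrix.mulVec, dotProduct]

theorem range_orbitMap_mem_nhds [Finite G]
    (hp : Algebra.adjoin ℝ (Set.range p) = invariantPolynomials G)
    {x : EuclideanSpace ℝ (Fin n)} (hx : x ∉ arrangementPoints G) :
    Set.range (orbitMap p) ∈ 𝓝 (orbitMap p x) := by
  have hdet : IsUnit (Matrix.of fun i j => polyValue (polyGradient (p i) j) x).det := by
    have hJ := polyValue_jacobian_ne_zero hp hx
    rw [jacobian, polyValue, RingHom.map_det] at hJ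
    exact hJ.isUnit
  have hunit := ((Matrix.isUnit_iff_isUnit_det _).2 hdet).map
    (Matrix.toEuclideanCLM (𝕜 := ℝ) (n := Fin n))
  rw [← (hasStrictFDerivAt_orbitMap p x).map_nhds_eq_of_surj (LinearMap.range_eq_top.2
    (ContinuousLinearMap.isUnit_iff_bijective.1 hunit).2)]
  exact Filter.range_mem_map

theorem exists_mem_arrangementPoints_orbitMap_eq [Finite G]
    (hp : Algebra.adjoin ℝ (Set.range p) = invariantPolynomials G)
    (x : EuclideanSpace ℝ (Fin n)) {u : EuclideanSpace ℝ (Fin n)} (hu : u ≠ 0)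
    (hK : Bornology.IsBounded {y | orbitMap p y - orbitMap p x ∈ ℝ ∙ u}) :
    ∃ y ∈ arrangementPoints G, ∃ t : ℝ, 0 ≤ t ∧ orbitMap p y = orbitMap p x + t • u := by
  have hclosed : IsClosed {y | orbitMap p y - orbitMap p x ∈ ℝ ∙ u} :=
    (ℝ ∙ u).closed_of_finiteDimensional.preimage
      ((continuous_orbitMap p).sub continuous_const)
  obtain ⟨y, t, ht, hy, hrange⟩ := exists_range_notMem_nhds_of_isCompact (continuous_orbitMap p) x
    hu (Metric.isCompact_of_isClosed_isBounded hclosed hK)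
  exact ⟨y, not_imp_comm.1 (range_orbitMap_mem_nhds hp) hrange, t, ht, hy⟩

end LocalSurjectivity

section Degrees

theorem homogeneousComponent_aeval {R σ τ : Type*} [CommSemiring R] {p : σ → MvPolynomial τ R}
    {d : σ → ℕ} (hp : ∀ i, (p i).IsHomogeneous (d i)) (k : ℕ) (F : MvPolynomial σ R) :
    homogeneousComponent k (aeval p F) = aeval p (weightedHomogeneousComponent d k F) := by
  induction F using MvPolynomial.induction_on' with
  | add F₁ F₂ h₁ h₂ => simp only [map_add, h₁, h₂]
  | monomial m r =>
    have hhom : (aeval p (monomial m r)).IsHomogeneous (Finsupp.weight d m) := by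
      rw [aeval_monomial, Finsupp.weight_apply, algebraMap_eq]
      refine (IsHomogeneous.prod _ _ (fun i => m i • d i) fun i _ => ?_).C_mul r
      rw [smul_eq_mul, mul_comm]
      exact (hp i).pow _
    rw [homogeneousComponent_of_mem ((mem_homogeneousSubmodule _ _).2 hhom),
      weightedHomogeneousComponent_of_mem
        ((mem_weightedHomogeneousSubmodule _ _ _ _).2 (isWeightedHomogeneous_monomial d m r rfl)),
      apply_ite (aeval p), map_zero]

theorem weight_le_totalDegree_aeval {R σ τ : Type*} [CommRing R] {p : σ → MvPolynomial τ R}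
    {d : σ → ℕ} (hp : ∀ i, (p i).IsHomogeneous (d i)) (hind : AlgebraicIndependent R p)
    {F : MvPolynomial σ R} {m : σ →₀ ℕ} (hm : m ∈ F.support) :
    Finsupp.weight d m ≤ (aeval p F).totalDegree := by
  by_contra! hlt
  have hcomp : weightedHomogeneousComponent d (Finsupp.weight d m) F = 0 :=
    hind (by rw [← homogeneousComponent_aeval hp, homogeneousComponent_eq_zero _ _ hlt, map_zero])
  have hcoeff := coeff_weightedHomogeneousComponent (w := d) (Finsupp.weight d m) F m
  rw [hcomp, coeff_zero, if_pos rfl] at hcoeff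
  exact mem_support_iff.1 hm hcoeff.symm

theorem two_mul_degree_le_weight {σ : Type*} {d : σ → ℕ} (hd : ∀ i, 2 ≤ d i) (m : σ →₀ ℕ) :
    2 * m.degree ≤ Finsupp.weight d m := by
  rw [Finsupp.degree_apply, Finsupp.weight_apply, Finset.mul_sum]
  exact Finset.sum_le_sum fun i _ => by rw [mul_comm]; exact Nat.mul_le_mul_left _ (hd i)

theorem eq_C_add_sum_of_totalDegree_le_one {R σ : Type*} [CommSemiring R] [Fintype σ]
    {B : MvPolynomial σ R} (hB : B.totalDegree ≤ 1) :
    B = C (coeff 0 B) + ∑ i, C (coeff (Finsupp.single i 1) B) * X i := by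
  classical
  ext m
  simp only [coeff_add, coeff_sum, coeff_C, coeff_C_mul, coeff_X, mul_ite, mul_one, mul_zero]
  rcases Nat.lt_trichotomy m.degree 1 with hm | hm | hm
  · obtain rfl := (Finsupp.degree_eq_zero_iff m).1 (by omega)
    simp
  · obtain ⟨i, rfl⟩ := (Set.ext_iff.1 Finsupp.range_single_one m).2 hm
    simp [Finsupp.single_left_inj, eq_comm (a := (0 : σ →₀ ℕ))]
  · rw [coeff_eq_zero_of_totalDegree_lt (hB.trans_lt hm), if_neg, zero_add, Finset.sum_eq_zero]
    · rintro i -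
      rw [if_neg]
      rintro rfl
      simp at hm
    · rintro rfl
      simp at hm

theorem homogeneousComponent_mul_of_totalDegree_le {R σ : Type*} [CommSemiring R]
    {f g : MvPolynomial σ R} {k l : ℕ} (hf : f.totalDegree ≤ k) (hg : g.totalDegree ≤ l) :
    homogeneousComponent (k + l) (f * g) = homogeneousComponent k f * homogeneousComponent l g := by
  classical
  ext m
  rw [coeff_homogeneousComponent]
  split_ifs with hm
  · rw [coeff_mul, coeff_mul]
    refine Finset.sum_congr rfl fun ab hab => ?_
    have hdeg : ab.1.degree + ab.2.degree = k + l := by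
      rw [← map_add, Finset.HasAntidiagonal.mem_antidiagonal.1 hab, hm]
    rw [coeff_homogeneousComponent, coeff_homogeneousComponent]
    rcases lt_trichotomy ab.1.degree k with hlt | heq | hgt
    · have hb : g.totalDegree < ab.2.degree := by omega
      simp [coeff_eq_zero_of_totalDegree_lt hb]
    · rw [if_pos heq, if_pos (by omega)]
    · simp [coeff_eq_zero_of_totalDegree_lt (hf.trans_lt hgt)]
  · exact (((homogeneousComponent_isHomogeneous k f).mul
      (homogeneousComponent_isHomogeneous l g)).coeff_eq_zero hm).symm

theorem homogeneousComponent_totalDegree_ne_zero {R σ : Type*} [CommSemiring R]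
    {f : MvPolynomial σ R} (hf : f ≠ 0) : homogeneousComponent f.totalDegree f ≠ 0 := by
  obtain ⟨m, hm, hdeg⟩ := Finset.exists_mem_eq_sup f.support (support_nonempty.2 hf)
    fun m => m.sum fun _ e => e
  intro h
  have hcoeff := coeff_homogeneousComponent f.totalDegree f m
  rw [h, coeff_zero, if_pos (show m.degree = f.totalDegree from hdeg.symm)] at hcoeff
  exact mem_support_iff.1 hm hcoeff.symm

theorem totalDegree_sum_sq {R σ ι : Type*} [CommRing R] [LinearOrder R] [IsStrictOrderedRing R]
    {s : Finset ι} {q : ι → MvPolynomial σ R} {l : ι} (hl : l ∈ s)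
    (hmax : ∀ i ∈ s, (q i).totalDegree ≤ (q l).totalDegree) :
    (∑ i ∈ s, q i ^ 2).totalDegree = 2 * (q l).totalDegree := by
  refine le_antisymm (totalDegree_finsetSum_le fun i hi =>
    (totalDegree_pow _ _).trans (Nat.mul_le_mul_left 2 (hmax i hi))) ?_
  by_contra! hlt
  have hsum : ∑ i ∈ s, homogeneousComponent (q l).totalDegree (q i) ^ 2 = 0 := by
    rw [← homogeneousComponent_eq_zero _ _ hlt, map_sum]
    refine Finset.sum_congr rfl fun i hi => ?_
    rw [sq, sq, two_mul, homogeneousComponent_mul_of_totalDegree_le (hmax i hi) (hmax i hi)]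
  have htop : homogeneousComponent (q l).totalDegree (q l) = 0 := MvPolynomial.funext fun x => by
    have hx := congrArg (eval x) hsum
    simp only [map_sum, map_pow, map_zero] at hx
    rw [Finset.sum_eq_zero_iff_of_nonneg fun _ _ => sq_nonneg _] at hx
    rw [map_zero, pow_eq_zero_iff two_ne_zero |>.1 (hx l hl)]
  have hl0 : q l ≠ 0 := by
    rintro h
    simp [h] at hlt
  exact homogeneousComponent_totalDegree_ne_zero hl0 htop

theorem totalDegree_sub_C {R σ : Type*} [CommRing R] (f : MvPolynomial σ R) (r : R) :
    (f - C r).totalDegree = f.totalDegree := by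
  rcases Nat.eq_zero_or_pos f.totalDegree with h | h
  · rw [h, totalDegree_eq_zero_iff_eq_C.1 h, ← C_sub, totalDegree_C]
  · rw [sub_eq_add_neg, ← C_neg]
    exact totalDegree_add_eq_left_of_totalDegree_lt (by rwa [totalDegree_C])

end Degrees

section Lines

variable {R σ : Type*} [CommSemiring R]

theorem natDegree_aeval_C_add_C_mul_X_le [Fintype σ] [DecidableEq R] {F : MvPolynomial σ R} {k : ℕ}
    (y : σ → R) {u : σ → R} (h : ∀ m ∈ F.support, ∑ i with u i ≠ 0, m i ≤ k) :
    (aeval (fun i => Polynomial.C (y i) + Polynomial.C (u i) * Polynomial.X) F).natDegree ≤ k := by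
  rw [aeval_def, eval₂_eq']
  refine Polynomial.natDegree_sum_le_of_forall_le _ _ fun m hm => ?_
  refine (Polynomial.natDegree_C_mul_le _ _).trans ?_
  refine (Polynomial.natDegree_prod_le _ _).trans (le_trans ?_ (h m hm))
  rw [Finset.sum_filter]
  refine Finset.sum_le_sum fun i _ => Polynomial.natDegree_pow_le.trans ?_
  split_ifs with hi
  · refine (Nat.mul_le_mul_left (m i) ?_).trans (mul_one _).le
    compute_degree
  · simp [not_not.1 hi]

theorem eval_aeval_C_add_C_mul_X (y u : σ → R) (F : MvPolynomial σ R) (t : R) :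
    (aeval (fun i => Polynomial.C (y i) + Polynomial.C (u i) * Polynomial.X) F).eval t =
      eval (y + t • u) F := by
  have hcomp : (Polynomial.aeval t).comp
      (aeval fun i => Polynomial.C (y i) + Polynomial.C (u i) * Polynomial.X) =
      (aeval (y + t • u) : MvPolynomial σ R →ₐ[R] R) := by
    ext i
    simp [mul_comm t]
  simpa [aeval_eq_eval, Polynomial.coe_aeval_eq_eval] using DFunLike.congr_fun hcomp F

theorem exists_forall_eval_add_smul_eq [Fintype σ] [DecidableEq R] {F : MvPolynomial σ R}
    {u : σ → R} (h : ∀ m ∈ F.support, ∑ i with u i ≠ 0, m i ≤ 1) (y : σ → R) :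
    ∃ β : R, ∀ t : R, eval (y + t • u) F = eval y F + t * β := by
  obtain ⟨β, c, hβc⟩ := Polynomial.exists_eq_X_add_C_of_natDegree_le_one
    (natDegree_aeval_C_add_C_mul_X_le y h)
  have hline : ∀ t, eval (y + t • u) F = t * β + c := fun t => by
    rw [← eval_aeval_C_add_C_mul_X, hβc]
    simp [mul_comm β]
  refine ⟨β, fun t => ?_⟩
  have hzero : eval y F = c := by simpa using hline 0
  rw [hline, hzero, add_comm]

end Lines

section OrbitSpaceLines

variable {n : ℕ} {G : Subgroup (EuclideanSpace ℝ (Fin n) ≃ₗᵢ[ℝ] EuclideanSpace ℝ (Fin n))}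
  {p : Fin n → MvPolynomial (Fin n) ℝ}

theorem polyValue_aeval (F : MvPolynomial (Fin n) ℝ) (x : EuclideanSpace ℝ (Fin n)) :
    polyValue (aeval p F) x = eval (orbitMap p x) F := by
  rw [polyValue, ← aeval_eq_eval, comp_aeval_apply, ← aeval_eq_eval]
  rfl

theorem mem_invariantPolynomials (hp : Algebra.adjoin ℝ (Set.range p) = invariantPolynomials G)
    (i : Fin n) : p i ∈ invariantPolynomials G :=
  hp ▸ Algebra.subset_adjoin (Set.mem_range_self i)

theorem exists_aeval_eq_of_mem_invariantPolynomials
    (hp : Algebra.adjoin ℝ (Set.range p) = invariantPolynomials G)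
    {f : MvPolynomial (Fin n) ℝ} (hf : f ∈ invariantPolynomials G) :
    ∃ F : MvPolynomial (Fin n) ℝ, aeval p F = f := by
  rwa [← hp, Algebra.adjoin_range_eq_range_aeval] at hf

theorem eq_zero_of_linearForm_mem_invariantPolynomials (hess : IsEssentialGroup G)
    {c : EuclideanSpace ℝ (Fin n)} (hc : linearForm c ∈ invariantPolynomials G) : c = 0 := by
  refine hess c fun g hg => ext_inner_right ℝ fun x => ?_
  simpa only [polyValue_linearForm, inner_inv_apply] using hc g hg x

theorem two_le_totalDegree_of_mem_invariantPolynomials (hess : IsEssentialGroup G)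
    {f : MvPolynomial (Fin n) ℝ} (hf : f ∈ invariantPolynomials G)
    (hhom : f.IsHomogeneous f.totalDegree) (h0 : f.totalDegree ≠ 0) : 2 ≤ f.totalDegree := by
  have h1 : f.totalDegree ≠ 1 := by
    intro h
    rw [h, ← mem_homogeneousSubmodule, homogeneousSubmodule_one_eq_span_X,
      Submodule.mem_span_range_iff_exists_fun] at hhom
    obtain ⟨c, hc⟩ := hhom
    have hlin : linearForm (WithLp.toLp 2 c) = f := by
      simp [← hc, linearForm_apply, smul_eq_C_mul]
    have hc0 := eq_zero_of_linearForm_mem_invariantPolynomials hess (hlin.symm ▸ hf)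
    simp [← hlin, hc0] at h
  omega

theorem IsBasicInvariants.two_le_totalDegree (hp : IsBasicInvariants G p)
    (hess : IsEssentialGroup G) (i : Fin n) : 2 ≤ (p i).totalDegree := by
  have h0 : (p i).totalDegree ≠ 0 := by
    intro h
    have htrans := hp.algebraicIndependent.transcendental i
    rw [totalDegree_eq_zero_iff_eq_C.1 h] at htrans
    exact htrans (isAlgebraic_algebraMap _)
  exact two_le_totalDegree_of_mem_invariantPolynomials hess
    (mem_invariantPolynomials hp.adjoin_eq i) (hp.homogeneous i) h0

/-- The polynomial `∑ Xᵢ²`, whose values are the squared Euclidean norms. -/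
noncomputable def normSqPoly (n : ℕ) : MvPolynomial (Fin n) ℝ := ∑ i, X i ^ 2

theorem polyValue_normSqPoly (x : EuclideanSpace ℝ (Fin n)) :
    polyValue (normSqPoly n) x = ‖x‖ ^ 2 := by
  simp [polyValue, normSqPoly, EuclideanSpace.norm_sq_eq]

theorem normSqPoly_mem : normSqPoly n ∈ invariantPolynomials G := by
  intro g _ x
  rw [polyValue_normSqPoly, polyValue_normSqPoly, LinearIsometryEquiv.norm_map]

theorem totalDegree_normSqPoly_le : (normSqPoly n).totalDegree ≤ 2 :=
  totalDegree_finsetSum_le fun i _ => (totalDegree_pow _ _).trans (by simp)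

theorem exists_norm_sq_eq_add_inner_orbitMap (hess : IsEssentialGroup G)
    (hp : IsBasicInvariants G p) : ∃ (c : ℝ) (b : EuclideanSpace ℝ (Fin n)),
      (∀ x, ‖x‖ ^ 2 = c + inner ℝ b (orbitMap p x)) ∧
      ∀ i, b i ≠ 0 → (p i).totalDegree ≤ 2 := by
  obtain ⟨B, hB⟩ :=
    exists_aeval_eq_of_mem_invariantPolynomials hp.adjoin_eq (normSqPoly_mem (G := G))
  have hweight : ∀ m ∈ B.support, Finsupp.weight (fun i => (p i).totalDegree) m ≤ 2 := fun m hm =>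
    (weight_le_totalDegree_aeval hp.homogeneous hp.algebraicIndependent hm).trans
      (hB ▸ totalDegree_normSqPoly_le)
  have hBdeg : B.totalDegree ≤ 1 := Finset.sup_le fun m hm => by
    have h := (two_mul_degree_le_weight (hp.two_le_totalDegree hess) m).trans (hweight m hm)
    change m.degree ≤ 1
    omega
  refine ⟨coeff 0 B, WithLp.toLp 2 fun i => coeff (Finsupp.single i 1) B, fun x => ?_,
    fun i hi => ?_⟩
  · rw [← polyValue_normSqPoly, ← hB, polyValue_aeval]
    conv_lhs => rw [eq_C_add_sum_of_totalDegree_le_one hBdeg]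
    simp [PiLp.inner_apply, mul_comm]
  · simpa [Finsupp.weight_single] using hweight _ (mem_support_iff.2 hi)

theorem exists_orbitMap_direction (hn : 2 ≤ n) (hess : IsEssentialGroup G)
    (hp : IsBasicInvariants G p) {F : MvPolynomial (Fin n) ℝ} {l : Fin n}
    {b : EuclideanSpace ℝ (Fin n)} (hb : ∀ i, b i ≠ 0 → (p i).totalDegree ≤ 2)
    (hF : (aeval p F).totalDegree < 2 * (p l).totalDegree) :
    ∃ u : EuclideanSpace ℝ (Fin n), u ≠ 0 ∧ inner ℝ b u = 0 ∧
      ∀ m ∈ F.support, ∑ i with u i ≠ 0, m i ≤ 1 := by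
  have hweight : ∀ m ∈ F.support, Finsupp.weight (fun i => (p i).totalDegree) m <
      2 * (p l).totalDegree := fun m hm =>
    (weight_le_totalDegree_aeval hp.homogeneous hp.algebraicIndependent hm).trans_lt hF
  by_cases hbl : b l = 0
  · -- the degree bound keeps `F` of degree at most one in the variable `l`
    refine ⟨EuclideanSpace.single l 1, by simp,
      by simp [EuclideanSpace.inner_single_right, hbl], fun m hm => ?_⟩
    have hml : m l * (p l).totalDegree < 2 * (p l).totalDegree := by
      refine lt_of_le_of_lt ?_ (hweight m hm)
      rw [Finsupp.weight_eq_sum]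
      exact Finset.single_le_sum (f := fun i => m i • (p i).totalDegree)
        (fun _ _ => Nat.zero_le _) (Finset.mem_univ l)
    have hfilter : (Finset.univ.filter fun i => EuclideanSpace.single l (1 : ℝ) i ≠ 0) = {l} := by
      ext i
      simp
    rw [hfilter, Finset.sum_singleton]
    exact Nat.le_of_lt_succ (lt_of_mul_lt_mul_right hml (Nat.zero_le _))
  · -- here `deg (p l) = 2`, so the degree of `aeval p F` is below four and `F` itself is affine
    have : Nontrivial (Fin n) := Fin.nontrivial_iff_two_le.2 hn
    obtain ⟨k, hkl⟩ := exists_ne l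
    refine ⟨EuclideanSpace.single k (b l) - EuclideanSpace.single l (b k), fun h => ?_, ?_,
      fun m hm => ?_⟩
    · simpa [hkl, hbl] using congrArg (fun v => v k) h
    · simp [inner_sub_right, EuclideanSpace.inner_single_right, mul_comm]
    · have hle := two_mul_degree_le_weight (hp.two_le_totalDegree hess) m
      have hlt := hweight m hm
      have hl := hb l hbl
      refine (Finset.sum_le_univ_sum_of_nonneg fun _ => Nat.zero_le _).trans ?_
      rw [← Finsupp.degree_eq_sum]
      omega

theorem exists_forall_polyValue_add_smul_eq {F : MvPolynomial (Fin n) ℝ}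
    {u : EuclideanSpace ℝ (Fin n)} (h : ∀ m ∈ F.support, ∑ i with u i ≠ 0, m i ≤ 1)
    (x : EuclideanSpace ℝ (Fin n)) : ∃ β : ℝ, ∀ y, ∀ t : ℝ, orbitMap p y = orbitMap p x + t • u →
      polyValue (aeval p F) y = polyValue (aeval p F) x + t * β := by
  obtain ⟨β, hβ⟩ := exists_forall_eval_add_smul_eq h (orbitMap p x)
  refine ⟨β, fun y t hy => ?_⟩
  rw [polyValue_aeval, polyValue_aeval, hy, ← hβ]
  rfl

theorem exists_mem_arrangementPoints_polyValue_le [Finite G] (hn : 2 ≤ n)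
    (hess : IsEssentialGroup G) (hp : IsBasicInvariants G p) {f : MvPolynomial (Fin n) ℝ}
    (hf : f ∈ invariantPolynomials G) {l : Fin n}
    (hdeg : f.totalDegree < 2 * (p l).totalDegree) (x : EuclideanSpace ℝ (Fin n)) :
    ∃ y ∈ arrangementPoints G, polyValue f y ≤ polyValue f x := by
  obtain ⟨F, rfl⟩ := exists_aeval_eq_of_mem_invariantPolynomials hp.adjoin_eq hf
  obtain ⟨c, b, hnorm, hb⟩ := exists_norm_sq_eq_add_inner_orbitMap hess hp
  obtain ⟨u, hu, hbu, hsupp⟩ := exists_orbitMap_direction hn hess hp hb hdeg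
  obtain ⟨β, hβ⟩ := exists_forall_polyValue_add_smul_eq (p := p) hsupp x
  obtain ⟨ε, hε, hεβ⟩ : ∃ ε : ℝ, ε ≠ 0 ∧ ε * β ≤ 0 := by
    rcases le_total 0 β with h | h
    · exact ⟨-1, by norm_num, by simpa using h⟩
    · exact ⟨1, one_ne_zero, by simpa using h⟩
  have hbounded : Bornology.IsBounded {y | orbitMap p y - orbitMap p x ∈ ℝ ∙ (ε • u)} := by
    refine (Metric.isBounded_closedBall (x := 0) (r := ‖x‖)).subset fun y hy => ?_
    obtain ⟨t, ht⟩ := Submodule.mem_span_singleton.1 hy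
    rw [mem_closedBall_zero_iff, ← sq_le_sq₀ (norm_nonneg _) (norm_nonneg _), hnorm, hnorm,
      ← sub_add_cancel (orbitMap p y) (orbitMap p x), ← ht]
    simp [inner_add_right, inner_smul_right, hbu]
  obtain ⟨y, hy, t, ht, hyt⟩ := exists_mem_arrangementPoints_orbitMap_eq hp.adjoin_eq x
    (smul_ne_zero hε hu) hbounded
  refine ⟨y, hy, ?_⟩
  rw [hβ y (t * ε) (by rw [hyt, smul_smul]), mul_assoc]
  exact add_le_of_nonpos_right (mul_nonpos_of_nonneg_of_nonpos ht hεβ)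

theorem exists_mem_arrangementPoints_le_polyValue [Finite G] (hn : 2 ≤ n)
    (hess : IsEssentialGroup G) (hp : IsBasicInvariants G p) {f : MvPolynomial (Fin n) ℝ}
    (hf : f ∈ invariantPolynomials G) {l : Fin n}
    (hdeg : f.totalDegree < 2 * (p l).totalDegree) (x : EuclideanSpace ℝ (Fin n)) :
    ∃ y ∈ arrangementPoints G, polyValue f x ≤ polyValue f y := by
  obtain ⟨y, hy, hle⟩ := exists_mem_arrangementPoints_polyValue_le hn hess hp (neg_mem hf)
    (by rwa [totalDegree_neg]) x
  exact ⟨y, hy, by simpa [polyValue] using hle⟩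

theorem starConvex_arrangementPoints : StarConvex ℝ 0 (arrangementPoints G) := by
  intro y hy a b _ _ _
  obtain ⟨g, hg, hr, hfix⟩ := mem_arrangementPoints.1 hy
  exact mem_arrangementPoints.2 ⟨g, hg, hr, by simp [hfix]⟩

theorem exists_mem_arrangementPoints_polyValue_eq {f : MvPolynomial (Fin n) ℝ} {r : ℝ}
    {y₁ y₂ : EuclideanSpace ℝ (Fin n)} (hy₁ : y₁ ∈ arrangementPoints G)
    (hy₂ : y₂ ∈ arrangementPoints G) (h₁ : polyValue f y₁ ≤ r) (h₂ : r ≤ polyValue f y₂) :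
    ∃ y ∈ arrangementPoints G, polyValue f y = r := by
  have hpath : IsPathConnected (arrangementPoints G) :=
    starConvex_arrangementPoints.isPathConnected
      (by simpa using starConvex_arrangementPoints.smul_mem hy₁ le_rfl zero_le_one)
  exact hpath.isConnected.isPreconnected.intermediate_value hy₁ hy₂
    (continuous_polyValue f).continuousOn ⟨h₁, h₂⟩

end OrbitSpaceLines

section OrbitSeparation

variable {n : ℕ} {G : Subgroup (EuclideanSpace ℝ (Fin n) ≃ₗᵢ[ℝ] EuclideanSpace ℝ (Fin n))}
  {p : Fin n → MvPolynomial (Fin n) ℝ}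

theorem IsOrthogonalReflection.ne_one
    {g : EuclideanSpace ℝ (Fin n) ≃ₗᵢ[ℝ] EuclideanSpace ℝ (Fin n)}
    (hg : IsOrthogonalReflection g) : g ≠ 1 := by
  obtain ⟨v, hv, rfl⟩ := hg
  intro h
  have hneg := Submodule.reflection_orthogonalComplement_singleton_eq_neg (𝕜 := ℝ) v
  rw [h] at hneg
  have htwo : (2 : ℝ) • v = 0 := by
    rw [two_smul]
    exact add_eq_zero_iff_eq_neg.2 hneg
  exact hv ((smul_eq_zero.1 htwo).resolve_left two_ne_zero)

theorem IsOrthogonalReflection.conj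
    {r : EuclideanSpace ℝ (Fin n) ≃ₗᵢ[ℝ] EuclideanSpace ℝ (Fin n)}
    (hr : IsOrthogonalReflection r)
    (g : EuclideanSpace ℝ (Fin n) ≃ₗᵢ[ℝ] EuclideanSpace ℝ (Fin n)) :
    IsOrthogonalReflection (g⁻¹ * r * g) := by
  obtain ⟨v, hv, rfl⟩ := hr
  refine ⟨g⁻¹ v, by simpa using hv, ?_⟩
  ext1 y
  have hinner : inner ℝ (g⁻¹ v) y = inner ℝ v (g y) := by rw [← inner_inv_apply, inv_inv]
  have hcancel : g⁻¹ (g y) = y := g.symm_apply_apply y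
  change g⁻¹ ((Submodule.span ℝ {v})ᗮ.reflection (g y)) = _
  simp only [Submodule.reflection_orthogonal_apply, Submodule.reflection_singleton_apply, map_neg,
    map_sub, map_nsmul, map_smul, hinner, hcancel, LinearIsometryEquiv.norm_map]

theorem mem_arrangementPoints_of_apply_mem
    {g : EuclideanSpace ℝ (Fin n) ≃ₗᵢ[ℝ] EuclideanSpace ℝ (Fin n)} (hg : g ∈ G)
    {a : EuclideanSpace ℝ (Fin n)} (h : g a ∈ arrangementPoints G) : a ∈ arrangementPoints G := by
  obtain ⟨r, hr, hrefl, hfix⟩ := mem_arrangementPoints.1 h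
  refine mem_arrangementPoints.2 ⟨g⁻¹ * r * g, G.mul_mem (G.mul_mem (G.inv_mem hg) hr) hg,
    hrefl.conj g, ?_⟩
  change g⁻¹ (r (g a)) = a
  rw [hfix]
  exact g.symm_apply_apply a

theorem exists_notMem_arrangementPoints [Finite G] : ∃ a, a ∉ arrangementPoints G := by
  obtain ⟨a, ha⟩ := exists_forall_apply_eq_imp_eq_one G
  refine ⟨a, fun hmem => ?_⟩
  obtain ⟨g, hg, hr, hfix⟩ := mem_arrangementPoints.1 hmem
  exact hr.ne_one (ha g hg hfix)

/-- The polynomial `∏ ‖x - g a‖²` over `g ∈ G`, which separates the orbit of `a` from the other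
orbits. -/
noncomputable def orbitDistSq
    (G : Subgroup (EuclideanSpace ℝ (Fin n) ≃ₗᵢ[ℝ] EuclideanSpace ℝ (Fin n))) [Fintype G]
    (a : EuclideanSpace ℝ (Fin n)) : MvPolynomial (Fin n) ℝ :=
  ∏ g : G, ∑ i, (X i - C (g.1 a i)) ^ 2

theorem polyValue_orbitDistSq [Fintype G] (a x : EuclideanSpace ℝ (Fin n)) :
    polyValue (orbitDistSq G a) x = ∏ g : G, ‖x - g.1 a‖ ^ 2 := by
  simp [polyValue, orbitDistSq, EuclideanSpace.norm_sq_eq]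

theorem orbitDistSq_mem [Fintype G] (a : EuclideanSpace ℝ (Fin n)) :
    orbitDistSq G a ∈ invariantPolynomials G := by
  intro h hh x
  rw [polyValue_orbitDistSq, polyValue_orbitDistSq,
    ← Equiv.prod_comp (Equiv.mulLeft (⟨h, hh⟩ : G)) fun g : G => ‖x - g.1 a‖ ^ 2]
  refine Finset.prod_congr rfl fun g _ => ?_
  rw [← LinearIsometryEquiv.norm_map h, map_sub]
  congr 3
  exact h.apply_symm_apply x

theorem orbitMap_eq_iff [Finite G]
    (hp : Algebra.adjoin ℝ (Set.range p) = invariantPolynomials G)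
    {a x : EuclideanSpace ℝ (Fin n)} : orbitMap p x = orbitMap p a ↔ ∃ g ∈ G, x = g a := by
  have := Fintype.ofFinite G
  constructor
  · intro h
    obtain ⟨F, hF⟩ := exists_aeval_eq_of_mem_invariantPolynomials hp (orbitDistSq_mem a)
    have hvalue : polyValue (orbitDistSq G a) x = polyValue (orbitDistSq G a) a := by
      rw [← hF, polyValue_aeval, polyValue_aeval, h]
    have hzero : polyValue (orbitDistSq G a) a = 0 := by
      rw [polyValue_orbitDistSq]
      exact Finset.prod_eq_zero (Finset.mem_univ 1) (by simp)
    rw [hzero, polyValue_orbitDistSq, Finset.prod_eq_zero_iff] at hvalue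
    obtain ⟨g, -, hg⟩ := hvalue
    exact ⟨g.1, g.2, by simpa [sub_eq_zero] using hg⟩
  · rintro ⟨g, hg, rfl⟩
    refine PiLp.ext fun i => ?_
    simpa [orbitMap] using mem_invariantPolynomials hp i g⁻¹ (G.inv_mem hg) a

/-- The polynomial `∑ (pᵢ - pᵢ(a))²`, which vanishes exactly on the fibre of `p` through `a`. -/
noncomputable def fibreSumSq (p : Fin n → MvPolynomial (Fin n) ℝ) (a : EuclideanSpace ℝ (Fin n)) :
    MvPolynomial (Fin n) ℝ :=
  ∑ i, (p i - C (polyValue (p i) a)) ^ 2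

theorem fibreSumSq_mem (hp : Algebra.adjoin ℝ (Set.range p) = invariantPolynomials G)
    (a : EuclideanSpace ℝ (Fin n)) : fibreSumSq p a ∈ invariantPolynomials G :=
  Subalgebra.sum_mem _ fun i _ => Subalgebra.pow_mem _
    (Subalgebra.sub_mem _ (mem_invariantPolynomials hp i) (Subalgebra.algebraMap_mem _ _)) 2

theorem realZeros_fibreSumSq (p : Fin n → MvPolynomial (Fin n) ℝ)
    (a : EuclideanSpace ℝ (Fin n)) :
    realZeros (fibreSumSq p a) = {x | orbitMap p x = orbitMap p a} := by
  ext x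
  simp only [realZeros, Set.mem_ofPred_eq, fibreSumSq, polyValue, map_sum, map_pow, map_sub,
    eval_C]
  rw [Finset.sum_eq_zero_iff_of_nonneg fun _ _ => sq_nonneg _]
  simp [sub_eq_zero, orbitMap, polyValue, funext_iff]

theorem totalDegree_fibreSumSq (a : EuclideanSpace ℝ (Fin n)) {l : Fin n}
    (hl : ∀ i, (p i).totalDegree ≤ (p l).totalDegree) :
    (fibreSumSq p a).totalDegree = 2 * (p l).totalDegree := by
  rw [fibreSumSq, totalDegree_sum_sq (Finset.mem_univ l) fun i _ => by
    simpa only [totalDegree_sub_C] using hl i, totalDegree_sub_C]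

end OrbitSeparation

end

theorem corollary3p6 (n : ℕ) (hn : 2 ≤ n)
    (G : Subgroup (EuclideanSpace ℝ (Fin n) ≃ₗᵢ[ℝ] EuclideanSpace ℝ (Fin n)))
    (hG : IsReflectionGroup G) (hess : IsEssentialGroup G)
    (p : Fin n → MvPolynomial (Fin n) ℝ) (hp : IsBasicInvariants G p) :
    -- the two equivalences below the degree bound
    (∀ f ∈ invariantPolynomials G,
      f.totalDegree < 2 * (p ⟨n - 1, by omega⟩).totalDegree →
        ((realZeros f).Nonempty ↔ (realZeros f ∩ arrangementPoints G).Nonempty) ∧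
        ((∀ x, 0 ≤ polyValue f x) ↔ ∀ x ∈ arrangementPoints G, 0 ≤ polyValue f x)) ∧
    -- tightness of the bound
    (∃ a, a ∉ arrangementPoints G) ∧
    (∀ a, a ∉ arrangementPoints G →
      ∀ f : MvPolynomial (Fin n) ℝ,
        f = ∑ i, (p i - MvPolynomial.C (polyValue (p i) a)) ^ 2 →
          f ∈ invariantPolynomials G ∧
          f.totalDegree = 2 * (p ⟨n - 1, by omega⟩).totalDegree ∧
          realZeros f = {x | ∃ g ∈ G, x = g a} ∧
          (realZeros f).Nonempty ∧
          realZeros f ∩ arrangementPoints G = ∅) := by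
  have := hG.finite
  refine ⟨fun f hf hdeg => ⟨⟨?_, fun h => h.mono Set.inter_subset_left⟩,
    fun h x _ => h x, fun h x => ?_⟩, exists_notMem_arrangementPoints, ?_⟩
  · rintro ⟨x, hx : polyValue f x = 0⟩
    obtain ⟨y₁, hy₁, hle⟩ := exists_mem_arrangementPoints_polyValue_le hn hess hp hf hdeg x
    obtain ⟨y₂, hy₂, hge⟩ := exists_mem_arrangementPoints_le_polyValue hn hess hp hf hdeg x
    obtain ⟨y, hy, hyx⟩ := exists_mem_arrangementPoints_polyValue_eq hy₁ hy₂ hle hge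
    exact ⟨y, hyx.trans hx, hy⟩
  · obtain ⟨y, hy, hle⟩ := exists_mem_arrangementPoints_polyValue_le hn hess hp hf hdeg x
    exact (h y hy).trans hle
  · rintro a ha f rfl
    have hzeros : realZeros (fibreSumSq p a) = {x | ∃ g ∈ G, x = g a} := by
      simp only [realZeros_fibreSumSq, orbitMap_eq_iff hp.adjoin_eq]
    have hlast : ∀ i, (p i).totalDegree ≤ (p ⟨n - 1, by omega⟩).totalDegree := fun i =>
      hp.degree_mono (Fin.le_def.2 (Nat.le_sub_one_of_lt i.2))
    refine ⟨fibreSumSq_mem hp.adjoin_eq a, totalDegree_fibreSumSq a hlast, hzeros,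
      ⟨a, hzeros.symm ▸ ⟨1, G.one_mem, rfl⟩⟩, Set.eq_empty_iff_forall_notMem.2 ?_⟩
    rintro x ⟨hx, hxH⟩
    obtain ⟨g, hg, rfl⟩ := (Set.ext_iff.1 hzeros x).1 hx
    exact ha (mem_arrangementPoints_of_apply_mem hg hxH)
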